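/- Let $X$ be a set. Maps are written on the right and composed from left to right; $T_X$ denotes the set of non-invertible maps $X\to X$, $E(T_X)$ the set of its idempotents, and for $e\in E(T_X)$ let $\pi_e=\{(x,y):xe=ye\}$ (an equivalence relation, also regarded as a partition of $X$). **Normal categories.** A *category with subobjects* is a category $\mathcal C$ with a wide subcategory of *inclusions* which is a preorder (at most one inclusion $j(c,d):c\to d$ for any objects $c,d$; write $c\subseteq d$ if it exists) such that $\subseteq$ is a partial order, every inclusion is a monomorphism of $\mathcal C$, and if $f=hg$ with $f,g$ inclusions then $h$ is an inclusion. A *retraction* is a morphism $e:d\to c$ with $c\subseteq d$ and $j(c,d)e=1_c$. A *normal factorization* of $f$ is $f=euj$ with $e$ a retraction, $u$ an isomorphism, $j$ an inclusion; $f^\circ=eu$ is the *epimorphic part* of $f$. A *cone* $\gamma$ with vertex $c_\gamma$ is a family of morphisms $\gamma(c):c\to c_\gamma$, one for each object $c$, with $j(c',c)\gamma(c)=\gamma(c')$ whenever $c'\subseteq c$; it is *normal* if some $\gamma(c)$ is an isomorphism. $\mathcal C$ is a *normal category* if every morphism has a normal factorization and for every object $c$ there is a normal cone $\sigma$ with vertex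 $c$ and $\sigma(c)=1_c$. In that case $f^\circ$ is well defined; for a normal cone $\gamma$ and an epimorphism $g$ from $c_\gamma$, $\gamma*g$ is the normal cone $a\mapsto\gamma(a)g$, and normal cones are multiplied by $\gamma*\sigma=\gamma*(\sigma(c_\gamma))^\circ$. The functor $H(\gamma;-):\mathcal C\to\mathbf{Set}$ is given by $H(\gamma;c)=\{\gamma*f^\circ: f:c_\gamma\to c\}$ and $H(\gamma;g):\gamma*f^\circ\mapsto\gamma*(fg)^\circ$. The *normal dual* $N^*\mathcal C$ is the full subcategory of the category of functors $\mathcal C\to\mathbf{Set}$ with objects $H(\varepsilon;-)$, $\varepsilon$ an idempotent normal cone; its inclusions are the natural transformations all of whose components are inclusions of sets. An *isomorphism of normal categories* is a functor that is bijective on objects, full and faithful, maps inclusions to inclusions, and is an order isomorphism on objects. **The two categories.** $\mathscr P(X)$ is the (normal) category of non-empty proper subsets of $X$ with all functions as morphisms and the usual inclusions. For $e\in E(T_X)$ the maps $e|_A:A\to\operatorname{Im}e$ form an idempotent normal cone of $\mathscr P(X)$ with vertex $\operatorname{Im}e$; write $H(e;-)$ for the corresponding functor. $\Pi(X)$ is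 the category whose objects are the sets $\bar\pi$ of all functions $\pi\to X$, for $\pi$ a partition of $X$ having a block with more than one element, and whose morphisms $\bar\pi_1\to\bar\pi_2$ are the maps $P_\eta:\alpha\mapsto\eta\alpha$ for functions $\eta:\pi_2\to\pi_1$; if every block of $\pi_2$ is contained in a block of $\pi_1$, and $\vartheta:\pi_2\to\pi_1$ sends each block to the block containing it, then $P_\vartheta:\bar\pi_1\to\bar\pi_2$ is an inclusion, and these are all the inclusions. **Theorem.** $N^*\mathscr P(X)$ and $\Pi(X)$ are normal categories and are isomorphic as normal categories. More precisely: 1. Every object of $N^*\mathscr P(X)$ is of the form $H(e;-)$ with $e\in E(T_X)$, and for every morphism $\sigma:H(e;-)\to H(f;-)$ there is a unique function $\hat\sigma:\operatorname{Im}f\to\operatorname{Im}e$ such that for every non-empty proper $C\subset X$ the component of $\sigma$ at $C$ is $e*h^\circ\mapsto f*(\hat\sigma h)^\circ$ $(h:\operatorname{Im}e\to C)$. 2. There are functors $P:N^*\mathscr P(X)\to\Pi(X)$ and $Q:\Pi(X)\to N^*\mathscr P(X)$ such that: - $P(H(e;-))=\bar\pi_e$, and $P(\sigma)=P_{\eta}$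 for $\sigma:H(e;-)\to H(f;-)$, where $\eta:\pi_f\to\pi_e$ sends the block $xf^{-1}$ to the block $(x\hat\sigma)e^{-1}$ for $x\in\operatorname{Im}f$; - $Q(\bar\pi_e)=H(e;-)$, and for $\eta:\pi_f\to\pi_e$ the natural transformation $Q(P_\eta):H(e;-)\to H(f;-)$ is $a\mapsto va$, where $v:X\to X$ sends $x$ to the element of $\operatorname{Im}e$ in the block $([x]_{\pi_f})\eta$, and a normal cone of $\mathscr P(X)$ is identified with the map $a:X\to X$ whose restrictions are its components. 3. $PQ=1_{N^*\mathscr P(X)}$ and $QP=1_{\Pi(X)}$ (composition from left to right), and $P$ and $Q$ are isomorphisms of normal categories; in particular they preserve inclusions and are order isomorphisms on objects. -/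

import Mathlib

open CategoryTheory

universe u v

/-! ### Categories with subobjects and normal categories

The subcategory of inclusions is given by the property `J` of being an inclusion.
Composition is written in diagrammatic order. -/

/-- `(C, J)` is a category with subobjects: `J` is (the set of morphisms of) a wide subcategory
which is a strict preorder, consists of monomorphisms of `C`, and satisfies
`f, g ∈ J`, `f = h g` imply `h ∈ J`. -/
structure IsCategoryWithSubobjects {C : Type u} [Category.{v} C] (J : MorphismProperty C) :
    Prop where
  id_mem : ∀ c : C, J (𝟙 c)
  comp_mem : ∀ {a b c : C} (f : a ⟶ b) (g : b ⟶ c), J f → J g → J (f ≫ g)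
  thin : ∀ {a b : C} (f g : a ⟶ b), J f → J g → f = g
  antisymm : ∀ {a b : C} (f : a ⟶ b) (g : b ⟶ a), J f → J g → a = b
  mono : ∀ {a b : C} (f : a ⟶ b), J f → Mono f
  of_comp : ∀ {a b c : C} (f : a ⟶ c) (g : b ⟶ c) (h : a ⟶ b), J f → J g → f = h ≫ g → J h

/-- The relation `c ⊆ d` on the objects: there is an inclusion from `c` to `d`. -/
def InclLE {C : Type u} [Category.{v} C] (J : MorphismProperty C) (c d : C) : Prop :=
  ∃ j : c ⟶ d, J j

/-- `e : d ⟶ c` is a retraction: `c ⊆ d` and `j(c, d) e = 1`. -/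
def IsRetraction {C : Type u} [Category.{v} C] (J : MorphismProperty C) {d c : C}
    (e : d ⟶ c) : Prop :=
  ∃ j : c ⟶ d, J j ∧ j ≫ e = 𝟙 c

/-- A normal factorization `f = e u j`: retraction, isomorphism, inclusion. -/
structure NormalFactorization {C : Type u} [Category.{v} C] (J : MorphismProperty C) {c d : C}
    (f : c ⟶ d) where
  coim : C
  im : C
  e : c ⟶ coim
  u : coim ⟶ im
  j : im ⟶ d
  retraction : IsRetraction J e
  iso : IsIso u
  incl : J j
  fac : e ≫ u ≫ j = f

/-- A cone from the base `vC` to the vertex `d`. -/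
@[ext]
structure ConeTo {C : Type u} [Category.{v} C] (J : MorphismProperty C) (d : C) where
  component : ∀ c : C, c ⟶ d
  naturality : ∀ {c' c : C} (j : c' ⟶ c), J j → j ≫ component c = component c'

/-- A cone is normal if one of its components is an isomorphism. -/
def ConeTo.IsNormal {C : Type u} [Category.{v} C] {J : MorphismProperty C} {d : C}
    (γ : ConeTo J d) : Prop :=
  ∃ c : C, IsIso (γ.component c)

/-- `(C, J)` is a normal category. -/
class IsNormalCategory {C : Type u} [Category.{v} C] (J : MorphismProperty C) : Prop where
  subobjects : IsCategoryWithSubobjects J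
  factorization : ∀ {c d : C} (f : c ⟶ d), Nonempty (NormalFactorization J f)
  cone : ∀ c : C, ∃ σ : ConeTo J c, σ.IsNormal ∧ σ.component c = 𝟙 c

/-- An isomorphism of normal categories: a functor that is bijective on objects, full and
faithful, maps inclusions to inclusions, and whose object map is an order isomorphism. -/
structure IsNormalCategoryIso {C : Type*} [Category C] {D : Type*} [Category D]
    (J : MorphismProperty C) (K : MorphismProperty D) (F : C ⥤ D) : Prop where
  v_injective : Function.Injective F.obj
  v_surjective : Function.Surjective F.obj
  full : F.Full
  faithful : F.Faithful
  map_incl : ∀ {a b : C} (f : a ⟶ b), J f → K (F.map f)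
  order_iff : ∀ a b : C, InclLE J a b ↔ InclLE K (F.obj a) (F.obj b)

/-! ### Normal cones and their products -/

/-- A normal cone, together with its vertex. -/
structure NormalCone {C : Type u} [Category.{v} C] (J : MorphismProperty C) where
  vertex : C
  cone : ConeTo J vertex
  normal : cone.IsNormal

section

variable {C : Type u} [Category.{v} C] (J : MorphismProperty C) [hJ : IsNormalCategory J]

/-- A chosen normal factorization of `f`. The image `im f` and the epimorphic part of `f`
do not depend on the choice. -/
noncomputable def normalFac {c d : C} (f : c ⟶ d) : NormalFactorization J f :=
  (hJ.factorization f).some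

/-- The codomain of the epimorphic part of `f`. -/
noncomputable abbrev imObj {c d : C} (f : c ⟶ d) : C := (normalFac J f).im

/-- The epimorphic part `f° = e u` of `f = e u j`. -/
noncomputable def epiPart {c d : C} (f : c ⟶ d) : c ⟶ imObj J f :=
  (normalFac J f).e ≫ (normalFac J f).u

theorem epiPart_fac {c d : C} (f : c ⟶ d) : epiPart J f ≫ (normalFac J f).j = f := by
  rw [epiPart, Category.assoc]; exact (normalFac J f).fac

theorem epiPart_epi {c d : C} (f : c ⟶ d) : Epi (epiPart J f) := by
  obtain ⟨j, -, hj⟩ := (normalFac J f).retraction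
  have : IsSplitEpi (normalFac J f).e := ⟨⟨⟨j, hj⟩⟩⟩
  have := (normalFac J f).iso
  exact epi_comp (normalFac J f).e (normalFac J f).u

/-- An epimorphism of a normal category is a retraction followed by an isomorphism. -/
theorem epi_retraction_iso {c d : C} (f : c ⟶ d) (hf : Epi f) :
    ∃ (c' : C) (e : c ⟶ c') (w : c' ⟶ d), IsRetraction J e ∧ IsIso w ∧ f = e ≫ w := by
  obtain ⟨F⟩ := hJ.factorization f
  refine ⟨F.coim, F.e, F.u ≫ F.j, F.retraction, ?_, F.fac.symm⟩
  have := F.iso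
  obtain ⟨σ, -, hσ⟩ := hJ.cone F.im
  have : Epi F.j := by
    have h : Epi ((F.e ≫ F.u) ≫ F.j) := by rw [Category.assoc, F.fac]; exact hf
    exact epi_of_epi (F.e ≫ F.u) F.j
  have : IsSplitMono F.j := ⟨⟨⟨σ.component d, by rw [σ.naturality F.j F.incl, hσ]⟩⟩⟩
  have : IsIso F.j := isIso_of_epi_of_isSplitMono F.j
  infer_instance

variable {J}

/-- The normal cone `γ * f`, with components `γ(a) f`, for an epimorphism `f` from the vertex
of `γ`. -/
def NormalCone.star (γ : NormalCone J) {d : C} (f : γ.vertex ⟶ d) (hf : Epi f) :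
    NormalCone J where
  vertex := d
  cone :=
    { component := fun a => γ.cone.component a ≫ f
      naturality := fun j hj => by rw [← Category.assoc, γ.cone.naturality j hj] }
  normal := by
    obtain ⟨c, hc⟩ := γ.normal
    obtain ⟨d', e, w, ⟨j, hj, hje⟩, hw, rfl⟩ := epi_retraction_iso J f hf
    obtain ⟨F⟩ := hJ.factorization (j ≫ inv (γ.cone.component c))
    obtain ⟨k, -, hk⟩ := F.retraction
    have := F.iso
    have h1 : (F.e ≫ F.u ≫ F.j) ≫ γ.cone.component c ≫ e = 𝟙 d' := by
      rw [F.fac]; simp [hje]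
    have : IsSplitEpi F.e := ⟨⟨⟨k, hk⟩⟩⟩
    have : IsSplitMono F.e :=
      ⟨⟨⟨F.u ≫ F.j ≫ γ.cone.component c ≫ e, by simpa using h1⟩⟩⟩
    have : IsIso F.e := isIso_of_epi_of_isSplitMono F.e
    have h2 : γ.cone.component F.im ≫ e = inv (F.e ≫ F.u) := by
      rw [← γ.cone.naturality F.j F.incl]
      apply IsIso.eq_inv_of_hom_inv_id
      simpa using h1
    refine ⟨F.im, ?_⟩
    change IsIso (γ.cone.component F.im ≫ e ≫ w)
    rw [← Category.assoc, h2]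
    infer_instance

/-- `γ * f°` for a morphism `f` from the vertex of `γ`. -/
noncomputable def NormalCone.starEpi (γ : NormalCone J) {c : C} (f : γ.vertex ⟶ c) :
    NormalCone J :=
  γ.star (epiPart J f) (epiPart_epi J f)

/-- The product of normal cones: `(γ * σ)(a) = γ(a) (σ(c_γ))°`. -/
noncomputable instance : Mul (NormalCone J) :=
  ⟨fun γ σ => γ.starEpi (σ.cone.component γ.vertex)⟩

theorem NormalCone.star_inj (γ : NormalCone J) {d d' : C} {f : γ.vertex ⟶ d}
    {f' : γ.vertex ⟶ d'} {hf : Epi f} {hf' : Epi f'} (h : γ.star f hf = γ.star f' hf') :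
    ∃ hd : d = d', f ≫ eqToHom hd = f' := by
  obtain rfl : d = d' := congrArg NormalCone.vertex h
  refine ⟨rfl, ?_⟩
  obtain ⟨c, hc⟩ := γ.normal
  have h1 : γ.cone.component c ≫ f = γ.cone.component c ≫ f' := by
    simp only [NormalCone.star, NormalCone.mk.injEq, heq_eq_eq, true_and, ConeTo.mk.injEq] at h
    exact congrFun h c
  simpa using (cancel_epi _).1 h1

theorem NormalCone.starEpi_inj (γ : NormalCone J) {c : C} {f f' : γ.vertex ⟶ c}
    (h : γ.starEpi f = γ.starEpi f') : f = f' := by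
  obtain ⟨hd, h1⟩ := γ.star_inj h
  have h2 : eqToHom hd ≫ (normalFac J f').j = (normalFac J f).j := by
    apply hJ.subobjects.thin
    · refine hJ.subobjects.comp_mem _ _ ?_ (normalFac J f').incl
      have : ∀ {a b : C} (h : a = b), J (eqToHom h) := by
        rintro a b rfl; exact hJ.subobjects.id_mem a
      exact this hd
    · exact (normalFac J f).incl
  rw [← epiPart_fac J f, ← epiPart_fac J f', ← h1, Category.assoc, h2]

theorem NormalCone.starEpi_id (γ : NormalCone J) : γ.starEpi (𝟙 γ.vertex) = γ := by
  have hfac := epiPart_fac J (𝟙 γ.vertex)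
  have hmem : J (epiPart J (𝟙 γ.vertex)) :=
    hJ.subobjects.of_comp _ _ _ (hJ.subobjects.id_mem _) (normalFac J (𝟙 γ.vertex)).incl hfac.symm
  have hd : imObj J (𝟙 γ.vertex) = γ.vertex :=
    hJ.subobjects.antisymm _ _ (normalFac J (𝟙 γ.vertex)).incl hmem
  have key : ∀ (d : C) (hd : d = γ.vertex) (f : γ.vertex ⟶ d) (hf : Epi f), J f →
      γ.star f hf = γ := by
    rintro d rfl f hf hfJ
    obtain rfl := hJ.subobjects.thin f (𝟙 _) hfJ (hJ.subobjects.id_mem _)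
    simp [NormalCone.star]
  exact key _ hd _ _ hmem

end

/-! ### Categories of sets, the functors `H(γ; -)` and the normal dual -/

/-- The full subcategory of the category of sets whose objects are the subsets of a fixed set `U`.
Two objects are equal exactly when they are equal as sets. -/
@[ext]
structure SubsetCat (U : Type u) where
  carrier : Set U

instance (U : Type u) : Category (SubsetCat U) where
  Hom A B := A.carrier → B.carrier
  id _ := id
  comp f g := g ∘ f

section

variable {C : Type u} [Category.{v} C] {J : MorphismProperty C} [hJ : IsNormalCategory J]

/-- The set `H(γ; c) = {γ * f° : f : c_γ ⟶ c}`. -/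
def hSet (γ : NormalCone J) (c : C) : Set (NormalCone J) :=
  {δ | ∃ f : γ.vertex ⟶ c, γ.starEpi f = δ}

/-- The functor `H(γ; -)`, with `H(γ; g) : γ * f° ↦ γ * (f g)°`. -/
noncomputable def hFunctor (γ : NormalCone J) : C ⥤ SubsetCat (NormalCone J) where
  obj c := ⟨hSet γ c⟩
  map g := fun δ => ⟨γ.starEpi (δ.2.choose ≫ g), _, rfl⟩
  map_id c := by
    funext δ
    apply Subtype.ext
    change γ.starEpi (δ.2.choose ≫ 𝟙 c) = δ.1
    rw [Category.comp_id, δ.2.choose_spec]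
  map_comp {a b c} g h := by
    funext δ
    apply Subtype.ext
    have hm : γ.starEpi (δ.2.choose ≫ g) ∈ hSet γ b := ⟨_, rfl⟩
    change γ.starEpi (δ.2.choose ≫ g ≫ h) = γ.starEpi (hm.choose ≫ h)
    rw [γ.starEpi_inj hm.choose_spec, Category.assoc]

/-- The element `γ * f°` of `H(γ; c)`. -/
noncomputable def hElt (γ : NormalCone J) {c : C} (f : γ.vertex ⟶ c) :
    ((hFunctor γ).obj c).carrier :=
  ⟨γ.starEpi f, f, rfl⟩

theorem hFunctor_map_hElt (γ : NormalCone J) {c d : C} (f : γ.vertex ⟶ c) (g : c ⟶ d) :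
    (hFunctor γ).map g (hElt γ f) = hElt γ (f ≫ g) := by
  apply Subtype.ext
  change γ.starEpi ((hElt γ f).2.choose ≫ g) = γ.starEpi (f ≫ g)
  rw [γ.starEpi_inj (hElt γ f).2.choose_spec]

variable (J) in
/-- The normal dual `N*C`: the full subcategory of the category of set-valued functors on `C`
whose objects are the functors `H(ε; -)`, `ε` an idempotent normal cone. All these functors take
values in the subsets of the set of normal cones. -/
abbrev NormalDual : Type _ :=
  ObjectProperty.FullSubcategory (C := C ⥤ SubsetCat (NormalCone J))
    (fun F => ∃ ε : NormalCone J, IsIdempotentElem ε ∧ F = hFunctor ε)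

variable (J) in
/-- The inclusions of the normal dual: the natural transformations all of whose components are
inclusions of sets. -/
def dualIncl : MorphismProperty (NormalDual J) :=
  fun F _ σ => ∀ (c : C) (x : (F.obj.obj c).carrier), (σ.hom.app c x).1 = x.1

/-- `H(ε; -)` as an object of the normal dual. -/
noncomputable def dualObj (ε : NormalCone J) (hε : IsIdempotentElem ε) : NormalDual J :=
  ⟨hFunctor ε, ε, hε, rfl⟩

/-- `v` is the morphism `σ̂`: for each `c`, the component of `σ` at `c` is the map
`ε * f° ↦ ε' * (v f)°`. -/
def IsHat {ε ε' : NormalCone J} {hε : IsIdempotentElem ε} {hε' : IsIdempotentElem ε'}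
    (σ : dualObj ε hε ⟶ dualObj ε' hε') (v : ε'.vertex ⟶ ε.vertex) : Prop :=
  ∀ (c : C) (f : ε.vertex ⟶ c), σ.hom.app c (hElt ε f) = hElt ε' (v ≫ f)

end

/-! ### The power-set category -/

/-- The objects of the power-set category: the non-empty proper subsets of `X`. -/
@[ext]
structure PowerSetCat (X : Type u) where
  carrier : Set X
  nonempty : carrier.Nonempty
  proper : carrier ≠ Set.univ

/-- The morphisms are all functions. -/
instance (X : Type u) : Category (PowerSetCat X) where
  Hom A B := A.carrier → B.carrier
  id _ := id
  comp f g := g ∘ f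

/-- The inclusions of the power-set category are the inclusions of sets. -/
def powerIncl (X : Type u) : MorphismProperty (PowerSetCat X) :=
  fun A _ f => ∀ x : A.carrier, (f x).1 = x.1

/-- The power-set category is a normal category. -/
instance powerSet_isNormalCategory (X : Type u) : IsNormalCategory (powerIncl X) where
  subobjects :=
    { id_mem := fun _ _ => rfl
      comp_mem := fun f g hf hg x => (hg (f x)).trans (hf x)
      thin := fun f g hf hg => funext fun x => Subtype.ext ((hf x).trans (hg x).symm)
      antisymm := fun {A B} f g hf hg => by
        ext x
        have h1 : ∀ hx : x ∈ A.carrier, (f ⟨x, hx⟩).1 = x := fun hx => hf ⟨x, hx⟩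
        have h2 : ∀ hx : x ∈ B.carrier, (g ⟨x, hx⟩).1 = x := fun hx => hg ⟨x, hx⟩
        exact ⟨fun hx => h1 hx ▸ (f ⟨x, hx⟩).2, fun hx => h2 hx ▸ (g ⟨x, hx⟩).2⟩
      mono := fun f hf => ⟨fun {Z} g h hgh => funext fun z => Subtype.ext <| by
        have : f (g z) = f (h z) := congrFun hgh z
        rw [← hf (g z), ← hf (h z), this]⟩
      of_comp := fun f g h hf hg hfg x => by
        rw [← hg (h x), ← hf x, hfg]; rfl }
  factorization {A B} f := by
    classical
    let s : B.carrier → X := fun b => if hb : ∃ a, f a = b then hb.choose.1 else A.nonempty.choose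
    have hsA : ∀ b, s b ∈ A.carrier := fun b => by
      by_cases hb : ∃ a, f a = b
      · simp only [s, hb, dite_true]; exact hb.choose.2
      · simp only [s, hb, dite_false]; exact A.nonempty.choose_spec
    have hs : ∀ a, f ⟨s (f a), hsA _⟩ = f a := fun a => by
      have hb : ∃ a', f a' = f a := ⟨a, rfl⟩
      have h1 : (⟨s (f a), hsA _⟩ : A.carrier) = hb.choose := Subtype.ext (by simp only [s, hb, dite_true])
      rw [h1]; exact hb.choose_spec
    obtain ⟨a₀, ha₀⟩ := A.nonempty
    let A' : PowerSetCat X :=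
      ⟨Set.range fun a : A.carrier => s (f a), ⟨_, ⟨a₀, ha₀⟩, rfl⟩, fun h => A.proper <| by
        rw [Set.eq_univ_iff_forall] at h ⊢
        intro x
        obtain ⟨a, rfl⟩ := h x
        exact hsA _⟩
    let B' : PowerSetCat X :=
      ⟨Set.range fun a : A.carrier => (f a).1, ⟨_, ⟨a₀, ha₀⟩, rfl⟩, fun h => B.proper <| by
        rw [Set.eq_univ_iff_forall] at h ⊢
        intro x
        obtain ⟨a, rfl⟩ := h x
        exact (f a).2⟩
    have hA' : ∀ x : A'.carrier, x.1 ∈ A.carrier := by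
      rintro ⟨x, a, rfl⟩; exact hsA _
    have hB' : ∀ x : B'.carrier, x.1 ∈ B.carrier := by
      rintro ⟨x, a, rfl⟩; exact (f a).2
    let e : A ⟶ A' := fun a => ⟨s (f a), a, rfl⟩
    let w : A' ⟶ B' := fun x => ⟨(f ⟨x.1, hA' x⟩).1, ⟨x.1, hA' x⟩, rfl⟩
    let w' : B' ⟶ A' := fun y => ⟨s ⟨y.1, hB' y⟩, by
      obtain ⟨y, a, rfl⟩ := y; exact ⟨a, rfl⟩⟩
    let j : B' ⟶ B := fun y => ⟨y.1, hB' y⟩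
    refine ⟨⟨A', B', e, w, j, ⟨fun x => ⟨x.1, hA' x⟩, fun _ => rfl, ?_⟩, ⟨w', ?_, ?_⟩,
      fun _ => rfl, ?_⟩⟩
    · funext x
      obtain ⟨x, a, rfl⟩ := x
      apply Subtype.ext
      change s (f ⟨s (f a), hsA _⟩) = s (f a)
      rw [hs]
    · funext x
      obtain ⟨x, a, rfl⟩ := x
      apply Subtype.ext
      change s (f ⟨s (f a), hsA _⟩) = s (f a)
      rw [hs]
    · funext y
      obtain ⟨y, a, rfl⟩ := y
      apply Subtype.ext
      change (f ⟨s (f a), hsA _⟩).1 = (f a).1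
      rw [hs]
    · funext a
      apply Subtype.ext
      change (f ⟨s (f a), hsA _⟩).1 = (f a).1
      rw [hs]
  cone A := by
    classical
    obtain ⟨a₀, ha₀⟩ := A.nonempty
    let r : X → A.carrier := fun x => if hx : x ∈ A.carrier then ⟨x, hx⟩ else ⟨a₀, ha₀⟩
    have hr : (fun x : A.carrier => r x.1) = 𝟙 A := by
      funext x
      simp only [r, x.2, dite_true]
      rfl
    refine ⟨⟨fun B => fun x => r x.1, fun j hj => funext fun x => ?_⟩, ⟨A, ?_⟩, hr⟩
    · change r (j x).1 = r x.1
      rw [hj x]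
    · change IsIso (C := PowerSetCat X) (X := A) (Y := A) (fun x => r x.1)
      rw [hr]
      infer_instance

/-- The idempotents of the semigroup of non-invertible transformations of `X`. -/
structure IdemTrans (X : Type u) where
  toFun : X → X
  idem : ∀ x, toFun (toFun x) = toFun x
  not_bijective : ¬ Function.Bijective toFun

namespace IdemTrans

variable {X : Type u} (e : IdemTrans X)

theorem apply_of_mem {x : X} (hx : x ∈ Set.range e.toFun) : e.toFun x = x := by
  obtain ⟨y, rfl⟩ := hx
  exact e.idem y

theorem exists_ne : ∃ x, e.toFun x ≠ x := by
  by_contra! h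
  have h1 : e.toFun = id := funext h
  exact e.not_bijective (h1 ▸ Function.bijective_id)

/-- `Im e` as an object of the power-set category. -/
def imageObj : PowerSetCat X where
  carrier := Set.range e.toFun
  nonempty := let ⟨x, _⟩ := e.exists_ne; ⟨_, x, rfl⟩
  proper h := by
    obtain ⟨x, hx⟩ := e.exists_ne
    exact hx (e.apply_of_mem (h ▸ Set.mem_univ x))

/-- The principal cone `ρ^e`, with vertex `Im e` and components the restrictions of `e`. -/
def principalCone : NormalCone (powerIncl X) where
  vertex := e.imageObj
  cone :=
    { component := fun _ => fun x => ⟨e.toFun x.1, x.1, rfl⟩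
      naturality := fun j hj => funext fun x => Subtype.ext (congrArg e.toFun (hj x)) }
  normal := by
    refine ⟨e.imageObj, ?_⟩
    have h : (fun x => ⟨e.toFun x.1, x.1, rfl⟩ : e.imageObj ⟶ e.imageObj) = 𝟙 e.imageObj := by
      funext x
      exact Subtype.ext (e.apply_of_mem x.2)
    change IsIso (C := PowerSetCat X) (X := e.imageObj) (Y := e.imageObj)
      (fun x => ⟨e.toFun x.1, x.1, rfl⟩)
    rw [h]
    infer_instance

theorem principalCone_idem : IsIdempotentElem e.principalCone := by
  have h : e.principalCone.cone.component e.principalCone.vertex = 𝟙 e.principalCone.vertex := by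
    funext x
    exact Subtype.ext (e.apply_of_mem x.2)
  change e.principalCone.starEpi (e.principalCone.cone.component e.principalCone.vertex) = _
  rw [h, NormalCone.starEpi_id]

/-- The object `H(e; -)` of the normal dual of the power-set category. -/
noncomputable def hObj : NormalDual (powerIncl X) :=
  dualObj e.principalCone e.principalCone_idem

end IdemTrans

/-- The normal cone `γ` of the power-set category is given by the transformation `α`, that is,
`γ(A)` is the restriction of `α` to `A` for all `A`. -/
def Represents {X : Type u} (γ : NormalCone (powerIncl X)) (α : X → X) : Prop :=
  ∀ (A : PowerSetCat X) (x : A.carrier), (γ.cone.component A x).1 = α x.1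

/-! ### The category of partitions

A partition is given by its equivalence relation `π`; its set of blocks is `Quotient π`. -/

/-- The objects `π̄` of `Π(X)`, indexed by the non-identity partitions `π` of `X`. -/
@[ext]
structure PartCat (X : Type u) where
  rel : Setoid X
  non_identity : ∃ x y, x ≠ y ∧ rel x y

namespace PartCat

variable {X : Type u}

/-- The set `π̄` of all functions from `π` to `X`. -/
abbrev Bar (p : PartCat X) : Type u := Quotient p.rel → X

/-- The map `P_η : π̄₁ → π̄₂`, `α ↦ η α`, for `η : π₂ → π₁`. -/
def precomp {p q : PartCat X} (η : Quotient q.rel → Quotient p.rel) : p.Bar → q.Bar :=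
  fun α => α ∘ η

/-- The morphisms of `Π(X)` from `π̄₁` to `π̄₂` are the maps `P_η`. -/
instance : Category (PartCat X) where
  Hom p q := {φ : p.Bar → q.Bar // ∃ η : Quotient q.rel → Quotient p.rel, φ = precomp η}
  id _ := ⟨id, id, rfl⟩
  comp φ ψ := ⟨ψ.1 ∘ φ.1, by
    obtain ⟨_, η, rfl⟩ := φ
    obtain ⟨_, θ, rfl⟩ := ψ
    exact ⟨η ∘ θ, rfl⟩⟩

/-- `P_η` as a morphism of `Π(X)`. -/
def homOf {p q : PartCat X} (η : Quotient q.rel → Quotient p.rel) : p ⟶ q :=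
  ⟨precomp η, η, rfl⟩

/-- The map `ϑ : π₂ → π₁` which sends a block of `π₂` to the block of `π₁` that contains it. -/
def coarsen {p q : PartCat X} (h : q.rel ≤ p.rel) : Quotient q.rel → Quotient p.rel :=
  Quotient.map id fun _ _ hxy => h hxy

end PartCat

/-- The inclusions of `Π(X)`: the morphisms `P_ϑ : π̄₁ ⟶ π̄₂`, where every block of `π₂` is
contained in a block of `π₁`. -/
def partIncl (X : Type u) : MorphismProperty (PartCat X) :=
  fun p q φ => ∃ h : q.rel ≤ p.rel, φ = PartCat.homOf (PartCat.coarsen h)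

namespace IdemTrans

variable {X : Type u}

/-- The object `π̄_e` of `Π(X)`, where `π_e = {(x, y) : x e = y e}`. -/
def partObj (e : IdemTrans X) : PartCat X where
  rel := Setoid.ker e.toFun
  non_identity := let ⟨x, hx⟩ := e.exists_ne; ⟨e.toFun x, x, hx, e.idem x⟩

/-- For `v : Im f → Im e`, the map `η_v : π_f → π_e`, `x f⁻¹ ↦ (x v) e⁻¹` for `x ∈ Im f`. -/
def eta {e f : IdemTrans X} (v : f.imageObj ⟶ e.imageObj) :
    Quotient f.partObj.rel → Quotient e.partObj.rel :=
  Quotient.lift (fun y => Quotient.mk e.partObj.rel (v ⟨f.toFun y, y, rfl⟩).1)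
    fun y z (hyz : f.toFun y = f.toFun z) => by
      have : (⟨f.toFun y, y, rfl⟩ : f.imageObj.carrier) = ⟨f.toFun z, z, rfl⟩ := Subtype.ext hyz
      rw [this]

/-- The transformation `v` determined by `η : π_f → π_e`: it sends `x` to the element of `Im e`
which lies in the block `η([x])` of `π_e`. -/
def trans {e f : IdemTrans X} (η : Quotient f.partObj.rel → Quotient e.partObj.rel) : X → X :=
  fun x => Setoid.kerLift e.toFun (η (Quotient.mk f.partObj.rel x))

end IdemTrans

/-! Both categories are described by transformations `w : X → X`. A normal cone of the power-set
category is the same thing as a map `α : X → X` whose image is its vertex, and `H(e; A)` consists of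
those `α` with values in `A` that are constant on the blocks of `π_e`. Hence `H(e; -)` and `π_e`
determine each other.

By the Yoneda lemma a morphism `H(e; -) ⟶ H(f; -)` is precomposition with some `w`. Such a morphism
exists for a given `w` exactly when `w` takes `π_f`-related points to `π_e`-related points, and two
choices of `w` give the same morphism exactly when they agree modulo `π_e`. The morphisms `P_η` obey
the same two rules (`IdemTrans.exists_hom_dualInduced_iff_partInduced`), and on both sides the
inclusions are the morphisms induced by `id`. So `P` and `Q` keep the inducing transformation, and
every identity between morphisms is checked by comparing transformations.

Normality is verified directly only for `Π(X)`, where retractions and cones come from choosing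
representatives of blocks. It is then carried to the normal dual along `P`. -/

/-! ### Transport of normality -/

/-- A normal category structure is transported backwards along an isomorphism of categories with
distinguished inclusions. -/
theorem IsNormalCategoryIso.isNormalCategory {C : Type*} [Category C] {D : Type*} [Category D]
    {J : MorphismProperty C} {K : MorphismProperty D} {F : C ⥤ D}
    (hF : IsNormalCategoryIso J K F) (hK : IsNormalCategory K) : IsNormalCategory J := by
  have := hF.full
  have := hF.faithful
  -- `F` also reflects inclusions: the order isomorphism supplies some inclusion `a ⟶ b`, and
  -- thinness of `K` with faithfulness forces it to be `f`.
  have map_iff : ∀ {a b : C} (f : a ⟶ b), K (F.map f) ↔ J f := fun {a b} f => by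
    refine ⟨fun h => ?_, hF.map_incl f⟩
    obtain ⟨j, hj⟩ := (hF.order_iff a b).2 ⟨_, h⟩
    rwa [F.map_injective (hK.subobjects.thin _ _ h (hF.map_incl j hj))]
  refine ⟨⟨fun c => ?_, fun f g hf hg => ?_, fun f g hf hg => ?_, fun f g hf hg => ?_,
    fun f hf => ?_, fun f g h hf hg hfg => ?_⟩, fun {c d} f => ?_, fun c => ?_⟩
  · rw [← map_iff, F.map_id]
    exact hK.subobjects.id_mem _
  · rw [← map_iff, F.map_comp]
    exact hK.subobjects.comp_mem _ _ (hF.map_incl f hf) (hF.map_incl g hg)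
  · exact F.map_injective (hK.subobjects.thin _ _ (hF.map_incl f hf) (hF.map_incl g hg))
  · exact hF.v_injective (hK.subobjects.antisymm _ _ (hF.map_incl f hf) (hF.map_incl g hg))
  · have := hK.subobjects.mono _ (hF.map_incl f hf)
    exact F.mono_of_mono_map this
  · rw [← map_iff]
    exact hK.subobjects.of_comp _ _ _ (hF.map_incl f hf) (hF.map_incl g hg)
      (by rw [hfg, F.map_comp])
  · obtain ⟨⟨a, b, e, w, j, ⟨k, hk, hke⟩, hw, hj, fac⟩⟩ := hK.factorization (F.map f)
    obtain ⟨a, rfl⟩ := hF.v_surjective a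
    obtain ⟨b, rfl⟩ := hF.v_surjective b
    obtain ⟨e, rfl⟩ := F.map_surjective e
    obtain ⟨w, rfl⟩ := F.map_surjective w
    obtain ⟨j, rfl⟩ := F.map_surjective j
    obtain ⟨k, rfl⟩ := F.map_surjective k
    refine ⟨⟨a, b, e, w, j, ⟨k, (map_iff k).1 hk, F.map_injective ?_⟩,
      isIso_of_fully_faithful F w, (map_iff j).1 hj, F.map_injective ?_⟩⟩
    · simpa using hke
    · simpa using fac
  · obtain ⟨σ, -, hσ⟩ := hK.cone (F.obj c)
    have hc : F.preimage (σ.component (F.obj c)) = 𝟙 c := F.map_injective (by simp [hσ])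
    refine ⟨⟨fun a => F.preimage (σ.component (F.obj a)), fun j hj => F.map_injective ?_⟩,
      ⟨c, ?_⟩, hc⟩
    · simpa using σ.naturality _ (hF.map_incl j hj)
    · change IsIso (F.preimage (σ.component (F.obj c)))
      rw [hc]
      infer_instance

/-- A functor with a strict inverse which matches inclusions is an isomorphism of normal
categories. -/
theorem IsNormalCategoryIso.of_inverse {C : Type*} [Category C] {D : Type*} [Category D]
    {J : MorphismProperty C} {K : MorphismProperty D} {F : C ⥤ D} {G : D ⥤ C}
    (hFG : F ⋙ G = 𝟭 C) (hGF : G ⋙ F = 𝟭 D)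
    (map_incl : ∀ {a b : C} (f : a ⟶ b), J f → K (F.map f))
    (order : ∀ a b : C, InclLE K (F.obj a) (F.obj b) → InclLE J a b) :
    IsNormalCategoryIso J K F where
  v_injective := Function.LeftInverse.injective (g := G.obj) fun c => Functor.congr_obj hFG c
  v_surjective := Function.RightInverse.surjective (g := G.obj) fun d => Functor.congr_obj hGF d
  full := (CategoryTheory.Equivalence.mk F G (eqToIso hFG.symm) (eqToIso hGF)).full_functor
  faithful :=
    (CategoryTheory.Equivalence.mk F G (eqToIso hFG.symm) (eqToIso hGF)).faithful_functor
  map_incl := map_incl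
  order_iff a b := ⟨fun ⟨j, hj⟩ => ⟨_, map_incl j hj⟩, order a b⟩

/-! ### Morphisms of the normal dual -/

section

variable {C : Type u} [Category.{v} C] {J : MorphismProperty C} [hJ : IsNormalCategory J]

/-- Idempotence reads `ε * (ε(c_ε))° = ε * 1°`, and `f ↦ ε * f°` is injective. -/
theorem NormalCone.component_vertex_of_idem {ε : NormalCone J} (hε : IsIdempotentElem ε) :
    ε.cone.component ε.vertex = 𝟙 ε.vertex :=
  ε.starEpi_inj (hε.trans ε.starEpi_id.symm)

theorem hElt_injective (γ : NormalCone J) {c : C} {f g : γ.vertex ⟶ c}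
    (h : hElt γ f = hElt γ g) : f = g :=
  γ.starEpi_inj (congrArg Subtype.val h)

theorem exists_hElt (γ : NormalCone J) {c : C} (a : ((hFunctor γ).obj c).carrier) :
    ∃ f : γ.vertex ⟶ c, hElt γ f = a := by
  obtain ⟨_, f, rfl⟩ := a
  exact ⟨f, rfl⟩

/-- Yoneda: `f ↦ ε * f°` identifies `Hom(c_ε, -)` with `H(ε; -)`, so `σ` is determined by the image
of the universal element `ε * 1°`. -/
theorem existsUnique_isHat {ε ε' : NormalCone J} {hε : IsIdempotentElem ε}
    {hε' : IsIdempotentElem ε'} (σ : dualObj ε hε ⟶ dualObj ε' hε') :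
    ∃! w : ε'.vertex ⟶ ε.vertex, IsHat σ w := by
  obtain ⟨w, hw⟩ := exists_hElt ε' (σ.hom.app ε.vertex (hElt ε (𝟙 ε.vertex)))
  refine ⟨w, fun c f => ?_, fun w' hw' => ?_⟩
  · have h := congrFun (σ.hom.naturality f) (hElt ε (𝟙 ε.vertex))
    change σ.hom.app c ((hFunctor ε).map f (hElt ε (𝟙 ε.vertex))) =
      (hFunctor ε').map f (σ.hom.app ε.vertex (hElt ε (𝟙 ε.vertex))) at h
    rwa [← hw, hFunctor_map_hElt, hFunctor_map_hElt, Category.id_comp] at h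
  · have h := hw' ε.vertex (𝟙 ε.vertex)
    rw [← hw, Category.comp_id] at h
    exact (hElt_injective ε' h).symm

theorem exists_isHat {ε ε' : NormalCone J} (hε : IsIdempotentElem ε)
    (hε' : IsIdempotentElem ε') (w : ε'.vertex ⟶ ε.vertex) :
    ∃ σ : dualObj ε hε ⟶ dualObj ε' hε', IsHat σ w := by
  choose r hr using fun (c : C) (a : ((hFunctor ε).obj c).carrier) => exists_hElt ε a
  have hr' : ∀ (c : C) (f : ε.vertex ⟶ c), r c (hElt ε f) = f := fun c f =>
    hElt_injective ε (hr c (hElt ε f))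
  let τ : hFunctor ε ⟶ hFunctor ε' :=
    { app := fun c a => hElt ε' (w ≫ r c a)
      naturality := fun c d g => funext fun a => by
        obtain ⟨f, rfl⟩ := exists_hElt ε a
        change hElt ε' (w ≫ r d ((hFunctor ε).map g (hElt ε f))) =
          (hFunctor ε').map g (hElt ε' (w ≫ r c (hElt ε f)))
        rw [hFunctor_map_hElt, hFunctor_map_hElt, hr', hr', Category.assoc] }
  refine ⟨ObjectProperty.homMk τ, fun c f => ?_⟩
  change hElt ε' (w ≫ r c (hElt ε f)) = _
  rw [hr']

end

/-- Functors with values in subsets of `U` agree if their values and the values of their maps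
agree in `U`. -/
theorem SubsetCat.functor_ext {C : Type*} [Category C] {U : Type u} {F G : C ⥤ SubsetCat U}
    (hobj : ∀ c, (F.obj c).carrier = (G.obj c).carrier)
    (hmap : ∀ {c d : C} (g : c ⟶ d) (x : (F.obj c).carrier) (y : (G.obj c).carrier),
      x.1 = y.1 → (F.map g x).1 = (G.map g y).1) : F = G := by
  have cast : ∀ {A B : SubsetCat U} (h : A = B) (x : A.carrier), (eqToHom h x).1 = x.1 := by
    rintro A _ rfl x
    rfl
  refine CategoryTheory.Functor.ext (fun c => SubsetCat.ext (hobj c)) fun c d g => ?_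
  funext x
  apply Subtype.ext
  exact (hmap g x _ (cast (SubsetCat.ext (hobj c)) x).symm).trans
    (cast (SubsetCat.ext (hobj d)).symm _).symm

/-! ### Normal cones of the power-set category as transformations -/

section

variable {X : Type u}

/-- `A` serves only as a witness that `X` has more than one point. -/
theorem PowerSetCat.singleton_ne_univ (A : PowerSetCat X) (x : X) : ({x} : Set X) ≠ Set.univ := by
  intro h
  obtain ⟨a, ha⟩ := A.nonempty
  refine A.proper (Set.eq_univ_iff_forall.2 fun y => ?_)
  have hy : y ∈ ({x} : Set X) := h ▸ Set.mem_univ y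
  have ha' : a ∈ ({x} : Set X) := h ▸ Set.mem_univ a
  rw [Set.mem_singleton_iff] at hy ha'
  rwa [hy, ← ha']

/-- The one-element subset `{x}`, which is proper as soon as there is a proper non-empty subset. -/
def PowerSetCat.singleton (A : PowerSetCat X) (x : X) : PowerSetCat X :=
  ⟨{x}, ⟨x, rfl⟩, A.singleton_ne_univ x⟩

/-- Naturality along `{x} ⊆ A` shows that a cone is determined by its values on singletons. -/
theorem exists_represents (γ : NormalCone (powerIncl X)) : ∃ α : X → X, Represents γ α := by
  refine ⟨fun x => (γ.cone.component (γ.vertex.singleton x) ⟨x, rfl⟩).1, fun A x => ?_⟩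
  let j : γ.vertex.singleton x.1 ⟶ A := fun y => ⟨y.1, by
    have hy : y.1 = x.1 := y.2
    rw [hy]
    exact x.2⟩
  exact congrArg Subtype.val (congrFun (γ.cone.naturality j fun _ => rfl) ⟨x.1, rfl⟩)

theorem Represents.unique {γ : NormalCone (powerIncl X)} {α β : X → X} (hα : Represents γ α)
    (hβ : Represents γ β) : α = β :=
  funext fun x => (hα (γ.vertex.singleton x) ⟨x, rfl⟩).symm.trans
    (hβ (γ.vertex.singleton x) ⟨x, rfl⟩)

/-- Normality gives surjectivity: some component is already a bijection onto the vertex. -/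
theorem Represents.range_eq {γ : NormalCone (powerIncl X)} {α : X → X} (hα : Represents γ α) :
    Set.range α = γ.vertex.carrier := by
  ext y
  constructor
  · rintro ⟨x, rfl⟩
    rw [← hα (γ.vertex.singleton x) ⟨x, rfl⟩]
    exact Subtype.coe_prop _
  · intro hy
    obtain ⟨A, hA⟩ := γ.normal
    let x := inv (γ.cone.component A) ⟨y, hy⟩
    have h : γ.cone.component A x = ⟨y, hy⟩ :=
      congrFun (IsIso.inv_hom_id (γ.cone.component A)) ⟨y, hy⟩
    exact ⟨x.1, by rw [← hα A x, h]⟩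

theorem Represents.cone_eq {γ δ : NormalCone (powerIncl X)} {α : X → X} (hγ : Represents γ α)
    (hδ : Represents δ α) : γ = δ := by
  obtain ⟨c, γ, hγn⟩ := γ
  obtain ⟨d, δ, hδn⟩ := δ
  obtain rfl : c = d := PowerSetCat.ext (hγ.range_eq.symm.trans hδ.range_eq)
  obtain rfl : γ = δ := by
    ext A
    funext x
    exact Subtype.ext ((hγ A x).trans (hδ A x).symm)
  rfl

/-- `h` and `h°` differ by an inclusion, which does not change values. This makes the chosen
factorization irrelevant in all later computations. -/
theorem epiPart_val {A B : PowerSetCat X} (h : A ⟶ B) (x : A.carrier) :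
    (epiPart (powerIncl X) h x).1 = (h x).1 := by
  rw [← (normalFac (powerIncl X) h).incl]
  exact congrArg Subtype.val (congrFun (epiPart_fac (powerIncl X) h) x)

namespace IdemTrans

theorem represents_principalCone (e : IdemTrans X) : Represents e.principalCone e.toFun :=
  fun _ _ => rfl

theorem represents_hElt (e : IdemTrans X) {A : PowerSetCat X} (h : e.imageObj ⟶ A) :
    Represents (hElt e.principalCone h).1 fun x => (h ⟨e.toFun x, x, rfl⟩).1 :=
  fun _ _ => epiPart_val _ _

theorem comp_of_represents (e : IdemTrans X) {A : PowerSetCat X}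
    (a : (e.hObj.obj.obj A).carrier) {α : X → X} (hα : Represents a.1 α) (x : X) :
    α (e.toFun x) = α x := by
  obtain ⟨h, rfl⟩ := exists_hElt e.principalCone a
  rw [hα.unique (e.represents_hElt h)]
  simp only [e.idem]

theorem range_subset_of_represents (e : IdemTrans X) {A : PowerSetCat X}
    (a : (e.hObj.obj.obj A).carrier) {α : X → X} (hα : Represents a.1 α) (x : X) :
    α x ∈ A.carrier := by
  obtain ⟨h, rfl⟩ := exists_hElt e.principalCone a
  rw [hα.unique (e.represents_hElt h)]
  exact Subtype.coe_prop _

/-- The elements of `H(e; A)` are the maps into `A` whose kernel contains `π_e`. -/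
theorem mem_hSet_iff (e : IdemTrans X) {A : PowerSetCat X} {γ : NormalCone (powerIncl X)}
    {α : X → X} (hα : Represents γ α) :
    γ ∈ hSet e.principalCone A ↔ (∀ x, α x ∈ A.carrier) ∧ ∀ x, α (e.toFun x) = α x := by
  constructor
  · exact fun h => ⟨e.range_subset_of_represents ⟨γ, h⟩ hα, e.comp_of_represents ⟨γ, h⟩ hα⟩
  · rintro ⟨hA, he⟩
    refine ⟨fun y => ⟨α y.1, hA y.1⟩, Represents.cone_eq (e.represents_hElt _) ?_⟩
    simpa only [he] using hα

theorem represents_map (e : IdemTrans X) {A B : PowerSetCat X} (g : A ⟶ B)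
    (a : (e.hObj.obj.obj A).carrier) {α : X → X} (hα : Represents a.1 α) :
    Represents (e.hObj.obj.map g a).1
      fun x => (g ⟨α x, e.range_subset_of_represents a hα x⟩).1 := by
  obtain ⟨h, rfl⟩ := exists_hElt e.principalCone a
  obtain rfl := hα.unique (e.represents_hElt h)
  change Represents ((hFunctor e.principalCone).map g (hElt e.principalCone h)).1 _
  rw [hFunctor_map_hElt]
  exact e.represents_hElt _

theorem partObj_eq_iff {e f : IdemTrans X} :
    e.partObj = f.partObj ↔ ∀ x y, e.toFun x = e.toFun y ↔ f.toFun x = f.toFun y := by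
  rw [PartCat.ext_iff, Setoid.ext_iff]
  rfl

/-- Equal kernels give `e (f x) = e x` and `f (e x) = f x`, so `α ∘ e = α` and `α ∘ f = α` are
equivalent; on maps both functors postcompose with `g`. -/
theorem hObj_eq_of_partObj_eq {e f : IdemTrans X} (h : e.partObj = f.partObj) :
    e.hObj = f.hObj := by
  rw [partObj_eq_iff] at h
  have he : ∀ x, e.toFun (f.toFun x) = e.toFun x := fun x => (h _ _).2 (f.idem x)
  have hf : ∀ x, f.toFun (e.toFun x) = f.toFun x := fun x => (h _ _).1 (e.idem x)
  refine ObjectProperty.FullSubcategory.ext (SubsetCat.functor_ext (fun A => ?_) ?_)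
  · ext γ
    obtain ⟨α, hα⟩ := exists_represents γ
    refine ((e.mem_hSet_iff hα).trans (and_congr_right fun _ => ?_)).trans
      (f.mem_hSet_iff hα).symm
    constructor
    · intro H x
      rw [← H, he, H]
    · intro H x
      rw [← H, hf, H]
  · intro A B g a b hab
    obtain ⟨α, hα⟩ := exists_represents a.1
    exact (e.represents_map g a hα).cone_eq (f.represents_map g b (hab ▸ hα))

/-- The cone of `e` lies in `H(e; Im e) = H(f; Im e)`, so `e` is constant on the blocks of `π_f`;
then exchange the roles. -/
theorem partObj_eq_of_hObj_eq {e f : IdemTrans X} (h : e.hObj = f.hObj) :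
    e.partObj = f.partObj := by
  have key : ∀ {e f : IdemTrans X}, e.hObj = f.hObj → ∀ x y, f.toFun x = f.toFun y →
      e.toFun x = e.toFun y := by
    intro e f h x y hxy
    have hm : e.principalCone ∈ hSet f.principalCone e.imageObj := by
      have h' : e.principalCone ∈ (e.hObj.obj.obj e.imageObj).carrier :=
        (e.mem_hSet_iff e.represents_principalCone).2 ⟨fun x => ⟨x, rfl⟩, e.idem⟩
      rw [h] at h'
      exact h'
    have hf := ((f.mem_hSet_iff e.represents_principalCone).1 hm).2
    rw [← hf x, ← hf y, hxy]
  exact partObj_eq_iff.2 fun x y => ⟨key h.symm x y, key h x y⟩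

/-- Send each point to a chosen representative of its block; a block with two points makes this map
non-injective. -/
theorem exists_partObj_eq (p : PartCat X) : ∃ e : IdemTrans X, e.partObj = p := by
  let s : X → X := fun x => (Quotient.mk p.rel x).out
  have hs : ∀ x, Quotient.mk p.rel (s x) = Quotient.mk p.rel x := fun x => Quotient.out_eq _
  have hiff : ∀ x y, s x = s y ↔ p.rel x y := fun x y =>
    ⟨fun h => Quotient.exact (by rw [← hs x, h, hs y]),
      fun h => congrArg Quotient.out (Quotient.sound h)⟩
  refine ⟨⟨s, fun x => congrArg Quotient.out (hs x), fun hb => ?_⟩,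
    PartCat.ext (Setoid.ext hiff)⟩
  obtain ⟨x, y, hne, hxy⟩ := p.non_identity
  exact hne (hb.1 ((hiff x y).2 hxy))

end IdemTrans

/-- The transformation of an idempotent cone maps onto the vertex and fixes it pointwise, so it is
idempotent, and it is not onto `X` because the vertex is proper. -/
theorem exists_hObj_eq (F : NormalDual (powerIncl X)) : ∃ e : IdemTrans X, F = e.hObj := by
  obtain ⟨F, ε, hε, rfl⟩ := F
  obtain ⟨α, hα⟩ := exists_represents ε
  have hmem : ∀ x, α x ∈ ε.vertex.carrier := fun x => hα.range_eq ▸ ⟨x, rfl⟩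
  have hfix : ∀ x ∈ ε.vertex.carrier, α x = x := fun x hx => by
    rw [← hα ε.vertex ⟨x, hx⟩, NormalCone.component_vertex_of_idem hε]
    rfl
  obtain ⟨e, rfl⟩ : ∃ e : IdemTrans X, e.principalCone = ε :=
    ⟨⟨α, fun x => hfix _ (hmem x), fun hb =>
      ε.vertex.proper (by rw [← hα.range_eq, hb.2.range_eq])⟩,
      (IdemTrans.represents_principalCone _).cone_eq hα⟩
  exact ⟨e, rfl⟩

/-! ### Morphisms induced by transformations -/

/-- The morphism `σ` of the normal dual is induced by `w : X → X`, that is, it acts on normal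
cones, regarded as maps, by `a ↦ w a`. -/
def DualInduced {F G : NormalDual (powerIncl X)} (σ : F ⟶ G) (w : X → X) : Prop :=
  ∀ (A : PowerSetCat X) (a : (F.obj.obj A).carrier) (α : X → X), Represents a.1 α →
    Represents (σ.hom.app A a).1 (α ∘ w)

theorem DualInduced.hom_eq {F G : NormalDual (powerIncl X)} {σ τ : F ⟶ G} {w : X → X}
    (hσ : DualInduced σ w) (hτ : DualInduced τ w) : σ = τ := by
  refine ObjectProperty.hom_ext _ (NatTrans.ext (funext fun A => funext fun a => Subtype.ext ?_))
  obtain ⟨α, hα⟩ := exists_represents a.1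
  exact (hσ A a α hα).cone_eq (hτ A a α hα)

theorem DualInduced.comp {F G H : NormalDual (powerIncl X)} {σ : F ⟶ G} {τ : G ⟶ H}
    {w w' : X → X} (hσ : DualInduced σ w) (hτ : DualInduced τ w') :
    DualInduced (σ ≫ τ) (w ∘ w') :=
  fun A a α hα => hτ A _ _ (hσ A a α hα)

theorem dualInduced_eqToHom {F G : NormalDual (powerIncl X)} (h : F = G) :
    DualInduced (eqToHom h) id := by
  subst h
  exact fun _ _ _ hα => hα

theorem dualIncl_iff {F G : NormalDual (powerIncl X)} (σ : F ⟶ G) :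
    dualIncl (powerIncl X) σ ↔ DualInduced σ id := by
  constructor
  · intro h A a α hα
    rw [h A a]
    exact hα
  · intro h A a
    obtain ⟨α, hα⟩ := exists_represents a.1
    exact (h A a α hα).cone_eq hα

/-- The morphism `φ = P_η` of `Π(X)` is induced by `w : X → X`, that is, `η [x] = [w x]`. -/
def PartInduced {p q : PartCat X} (φ : p ⟶ q) (w : X → X) : Prop :=
  ∀ (α : p.Bar) (x : X), φ.1 α (Quotient.mk q.rel x) = α (Quotient.mk p.rel (w x))

theorem PartInduced.hom_eq {p q : PartCat X} {φ ψ : p ⟶ q} {w : X → X}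
    (hφ : PartInduced φ w) (hψ : PartInduced ψ w) : φ = ψ := by
  refine Subtype.ext (funext fun α => funext fun b => ?_)
  induction b using Quotient.inductionOn with
  | h x => exact (hφ α x).trans (hψ α x).symm

theorem PartInduced.comp {p q r : PartCat X} {φ : p ⟶ q} {ψ : q ⟶ r} {w w' : X → X}
    (hφ : PartInduced φ w) (hψ : PartInduced ψ w') : PartInduced (φ ≫ ψ) (w ∘ w') :=
  fun α x => (hψ (φ.1 α) x).trans (hφ α (w' x))

theorem partInduced_eqToHom {p q : PartCat X} (h : p = q) : PartInduced (eqToHom h) id := by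
  subst h
  exact fun _ _ => rfl

/-- The functions on the blocks of a non-identity partition separate the blocks. -/
theorem PartCat.bar_separates (p : PartCat X) {b c : Quotient p.rel}
    (h : ∀ α : p.Bar, α b = α c) : b = c := by
  classical
  obtain ⟨x, y, hxy, -⟩ := p.non_identity
  by_contra hbc
  -- A two-valued function is available because a non-identity partition provides two distinct
  -- points of `X`.
  have h' := h fun d => if d = b then x else y
  simp only [if_true, if_neg (Ne.symm hbc)] at h'
  exact hxy h'

theorem partInduced_homOf_iff {p q : PartCat X} (η : Quotient q.rel → Quotient p.rel)
    (w : X → X) :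
    PartInduced (PartCat.homOf η) w ↔ ∀ x, η (Quotient.mk q.rel x) = Quotient.mk p.rel (w x) :=
  ⟨fun h x => p.bar_separates fun α => h α x, fun h α x => congrArg α (h x)⟩

theorem PartCat.exists_homOf {p q : PartCat X} (φ : p ⟶ q) :
    ∃ η : Quotient q.rel → Quotient p.rel, φ = homOf η := by
  obtain ⟨_, η, rfl⟩ := φ
  exact ⟨η, rfl⟩

theorem PartCat.exists_partInduced {p q : PartCat X} (φ : p ⟶ q) :
    ∃ w : X → X, PartInduced φ w := by
  obtain ⟨η, rfl⟩ := exists_homOf φ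
  exact ⟨fun x => (η (Quotient.mk q.rel x)).out,
    (partInduced_homOf_iff _ _).2 fun x => (Quotient.out_eq _).symm⟩

theorem exists_hom_partInduced_iff {p q : PartCat X} (w : X → X) :
    (∃ φ : p ⟶ q, PartInduced φ w) ↔ ∀ x y, q.rel x y → p.rel (w x) (w y) := by
  constructor
  · rintro ⟨φ, hφ⟩ x y hxy
    obtain ⟨η, rfl⟩ := PartCat.exists_homOf φ
    rw [partInduced_homOf_iff] at hφ
    exact Quotient.exact (by rw [← hφ, ← hφ, Quotient.sound hxy])
  · intro h
    exact ⟨PartCat.homOf (Quotient.map w h), (partInduced_homOf_iff _ _).2 fun _ => rfl⟩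

/-- With `PartInduced.congr`: the inducing transformation is unique exactly up to the source
partition. -/
theorem PartInduced.rel {p q : PartCat X} {φ : p ⟶ q} {w w' : X → X}
    (h : PartInduced φ w) (h' : PartInduced φ w') (x : X) : p.rel (w x) (w' x) :=
  Quotient.exact (p.bar_separates fun α => (h α x).symm.trans (h' α x))

theorem PartInduced.congr {p q : PartCat X} {φ : p ⟶ q} {w w' : X → X}
    (h : PartInduced φ w) (hw : ∀ x, p.rel (w x) (w' x)) : PartInduced φ w' := fun α x => by
  rw [h α x, Quotient.sound (hw x)]

theorem partIncl_iff {p q : PartCat X} (φ : p ⟶ q) : partIncl X φ ↔ PartInduced φ id := by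
  constructor
  · rintro ⟨h, rfl⟩
    exact (partInduced_homOf_iff _ _).2 fun _ => rfl
  · intro h
    have hle : q.rel ≤ p.rel := fun {x y} hxy =>
      (exists_hom_partInduced_iff id).1 ⟨φ, h⟩ x y hxy
    exact ⟨hle, h.hom_eq ((partInduced_homOf_iff _ _).2 fun _ => rfl)⟩

/-! ### The partition category is normal -/

theorem partIncl_isCategoryWithSubobjects : IsCategoryWithSubobjects (partIncl X) where
  id_mem p := (partIncl_iff _).2 fun _ _ => rfl
  comp_mem f g hf hg := (partIncl_iff _).2 (((partIncl_iff f).1 hf).comp ((partIncl_iff g).1 hg))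
  thin f g hf hg := ((partIncl_iff f).1 hf).hom_eq ((partIncl_iff g).1 hg)
  antisymm := by
    rintro p q f g ⟨h, -⟩ ⟨h', -⟩
    exact PartCat.ext (le_antisymm h' h)
  mono {p q} f hf := ⟨fun {r} g h hgh => by
    rw [partIncl_iff] at hf
    obtain ⟨w, hw⟩ := PartCat.exists_partInduced g
    refine hw.hom_eq fun α x => ?_
    rw [← hw α x]
    -- The block map of an inclusion is onto, so evaluation at the finer block of `x` recovers the
    -- value at the coarser one.
    have hx := congrFun (congrFun (congrArg Subtype.val hgh) α) (Quotient.mk q.rel x)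
    exact ((hf (h.1 α) x).symm.trans hx.symm).trans (hf (g.1 α) x)⟩
  of_comp {p q r} f g h hf hg hfg := by
    rw [partIncl_iff] at hf hg ⊢
    intro α x
    refine (hg (h.1 α) x).symm.trans ?_
    rw [← hf α x, hfg]
    rfl

/-- The blocks of `b` (fibres of the block map `η` of `φ`) and those of `a` both correspond to the
image of `η`. Here `a` coarsens `p` by merging each block outside the image with the block of `w
x₀`; any other default would do. The factors are induced by `w ∘ r`, `w` and `id`, the inverse of
the isomorphism by `r`, and every required identity reduces to `w r w = w` modulo `p`. -/
theorem PartCat.exists_normalFactorization {p q : PartCat X} (φ : p ⟶ q) :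
    Nonempty (NormalFactorization (partIncl X) φ) := by
  classical
  obtain ⟨w, hw⟩ := exists_partInduced φ
  have hwr := (exists_hom_partInduced_iff w).1 ⟨φ, hw⟩
  obtain ⟨x₀, -⟩ := p.non_identity
  -- `s` picks a preimage under `w` of each block met by `w`, so that `w ∘ s` retracts onto them
  let s : Quotient p.rel → X := fun b => if hb : ∃ y, Quotient.mk p.rel (w y) = b then hb.choose
    else x₀
  have hs : ∀ y, Quotient.mk p.rel (w (s (Quotient.mk p.rel (w y)))) = Quotient.mk p.rel (w y) :=
    fun y => by
      have hb : ∃ y', Quotient.mk p.rel (w y') = Quotient.mk p.rel (w y) := ⟨y, rfl⟩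
      have h1 : s (Quotient.mk p.rel (w y)) = hb.choose := dif_pos hb
      rw [h1]
      exact hb.choose_spec
  let r : X → X := fun x => s (Quotient.mk p.rel x)
  have hr : ∀ y, p.rel (w (r (w y))) (w y) := fun y => Quotient.exact (hs y)
  let a : PartCat X := ⟨p.rel.comap (w ∘ r), by
    obtain ⟨x, y, hxy, h⟩ := p.non_identity
    refine ⟨x, y, hxy, ?_⟩
    change p.rel (w (s (Quotient.mk p.rel x))) (w (s (Quotient.mk p.rel y)))
    rw [Quotient.sound h]⟩
  let b : PartCat X := ⟨p.rel.comap w, by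
    obtain ⟨x, y, hxy, h⟩ := q.non_identity
    exact ⟨x, y, hxy, hwr x y h⟩⟩
  have ha : ∀ x y, a.rel x y ↔ p.rel (w (r x)) (w (r y)) := fun _ _ => Iff.rfl
  have hb : ∀ x y, b.rel x y ↔ p.rel (w x) (w y) := fun _ _ => Iff.rfl
  have hpa : ∀ x y, p.rel x y → a.rel x y := fun x y h => by
    rw [ha]
    change p.rel (w (s (Quotient.mk p.rel x))) (w (s (Quotient.mk p.rel y)))
    rw [Quotient.sound h]
  obtain ⟨e, he⟩ := (exists_hom_partInduced_iff (p := p) (q := a) (w ∘ r)).2 fun x y h => h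
  obtain ⟨k, hk⟩ := (exists_hom_partInduced_iff (p := a) (q := p) id).2 hpa
  obtain ⟨u, hu⟩ := (exists_hom_partInduced_iff (p := a) (q := b) w).2 fun x y h => hpa _ _ h
  obtain ⟨u', hu'⟩ := (exists_hom_partInduced_iff (p := b) (q := a) r).2 fun x y h => h
  obtain ⟨j, hj⟩ := (exists_hom_partInduced_iff (p := b) (q := q) id).2 hwr
  refine ⟨⟨a, b, e, u, j, ⟨k, (partIncl_iff k).2 hk, ?_⟩, ⟨u', ?_, ?_⟩, (partIncl_iff j).2 hj, ?_⟩⟩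
  · exact ((hk.comp he).congr fun x => (ha _ _).2 (hr _)).hom_eq (partInduced_eqToHom rfl)
  · exact ((hu.comp hu').congr fun x => (ha _ _).2 (hr _)).hom_eq (partInduced_eqToHom rfl)
  · exact ((hu'.comp hu).congr fun x => (hb _ _).2 (hr _)).hom_eq (partInduced_eqToHom rfl)
  · exact ((he.comp (hu.comp hj)).congr fun x => hr _).hom_eq hw

/-- The map `s` to representatives is constant on the blocks of `p`, so it induces a morphism `q ⟶
p` for every `q`; for `q = p` this is the identity since `s x` lies in the block of `x`. -/
theorem PartCat.exists_cone (p : PartCat X) :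
    ∃ σ : ConeTo (partIncl X) p, σ.IsNormal ∧ σ.component p = 𝟙 p := by
  let s : X → X := fun x => (Quotient.mk p.rel x).out
  have hs : ∀ x, p.rel (s x) x := fun x => Quotient.exact (Quotient.out_eq _)
  have hrel : ∀ (q : PartCat X) (x y : X), p.rel x y → q.rel (s x) (s y) := fun q x y h => by
    have hxy : s x = s y := congrArg Quotient.out (Quotient.sound h)
    rw [hxy]
  choose σ hσ using fun q : PartCat X => (exists_hom_partInduced_iff s).2 (hrel q)
  have hp : σ p = 𝟙 p := ((hσ p).congr hs).hom_eq (partInduced_eqToHom rfl)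
  refine ⟨⟨σ, fun {q' q} j hj => (((partIncl_iff j).1 hj).comp (hσ q)).hom_eq (hσ q')⟩,
    ⟨p, ?_⟩, hp⟩
  change IsIso (σ p)
  rw [hp]
  infer_instance

theorem partIncl_isNormalCategory : IsNormalCategory (partIncl X) where
  subobjects := partIncl_isCategoryWithSubobjects
  factorization := PartCat.exists_normalFactorization
  cone := PartCat.exists_cone

/-! ### The correspondence between the morphisms of the two categories -/

namespace IdemTrans

variable {e f : IdemTrans X}

theorem dualInduced_of_isHat {σ : e.hObj ⟶ f.hObj} {w : f.imageObj ⟶ e.imageObj}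
    (h : IsHat σ w) : DualInduced σ fun x => (w ⟨f.toFun x, x, rfl⟩).1 := by
  intro A a α hα
  obtain ⟨g, rfl⟩ := exists_hElt e.principalCone a
  obtain rfl := hα.unique (e.represents_hElt g)
  rw [h A g]
  have hfix : ∀ y : e.imageObj.carrier, (⟨e.toFun y.1, y.1, rfl⟩ : e.imageObj.carrier) = y :=
    fun y => Subtype.ext (e.apply_of_mem y.2)
  have := f.represents_hElt (w ≫ g)
  refine cast (congrArg _ (funext fun x => ?_)) this
  exact congrArg (fun y => (g y).1) (hfix (w ⟨f.toFun x, x, rfl⟩)).symm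

theorem exists_dualInduced (σ : e.hObj ⟶ f.hObj) : ∃ w : X → X, DualInduced σ w :=
  let ⟨_, hw, _⟩ := existsUnique_isHat σ
  ⟨_, dualInduced_of_isHat hw⟩

theorem represents_app_principalCone {σ : e.hObj ⟶ f.hObj} {w : X → X} (h : DualInduced σ w) :
    Represents (σ.hom.app e.imageObj (hElt e.principalCone (𝟙 e.imageObj))).1 (e.toFun ∘ w) :=
  h _ _ _ (e.represents_hElt (𝟙 e.imageObj))

/-- Test on the universal element, the cone of `e`, whose image has transformation `e ∘ w`. -/
theorem apply_eq_of_dualInduced {σ : e.hObj ⟶ f.hObj} {w w' : X → X}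
    (h : DualInduced σ w) (h' : DualInduced σ w') (x : X) : e.toFun (w x) = e.toFun (w' x) :=
  congrFun ((represents_app_principalCone h).unique (represents_app_principalCone h')) x

/-- Every element of `H(e; A)` factors through `e`, so only `e ∘ w` matters. -/
theorem dualInduced_congr {σ : e.hObj ⟶ f.hObj} {w w' : X → X} (h : DualInduced σ w)
    (hw : ∀ x, e.toFun (w x) = e.toFun (w' x)) : DualInduced σ w' := by
  intro A a α hα
  have hαw : α ∘ w' = α ∘ w := funext fun x => by
    rw [Function.comp_apply, Function.comp_apply, ← e.comp_of_represents a hα (w' x), ← hw,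
      e.comp_of_represents a hα]
  rw [hαw]
  exact h A a α hα

/-- Necessity: the image `e ∘ w` of the universal element must be constant on the blocks of `π_f`.
Sufficiency: take `σ̂` to be `e ∘ w` on `Im f`; the induced transformation `e ∘ w ∘ f` agrees with
`w` modulo `π_e`. -/
theorem exists_hom_dualInduced_iff (w : X → X) :
    (∃ σ : e.hObj ⟶ f.hObj, DualInduced σ w) ↔
      ∀ x y, f.toFun x = f.toFun y → e.toFun (w x) = e.toFun (w y) := by
  constructor
  · rintro ⟨σ, hσ⟩ x y hxy
    have h := f.comp_of_represents _ (represents_app_principalCone hσ)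
    have hx := h x
    rw [hxy, h y] at hx
    exact hx.symm
  · intro h
    obtain ⟨σ, hσ⟩ := exists_isHat e.principalCone_idem f.principalCone_idem
      (fun y => ⟨e.toFun (w y.1), w y.1, rfl⟩ : f.imageObj ⟶ e.imageObj)
    refine ⟨σ, dualInduced_congr (dualInduced_of_isHat hσ) fun x => ?_⟩
    change e.toFun (e.toFun (w (f.toFun x))) = _
    rw [e.idem]
    exact h _ _ (f.idem x)

theorem exists_hom_dualInduced_iff_partInduced (w : X → X) :
    (∃ σ : e.hObj ⟶ f.hObj, DualInduced σ w) ↔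
      ∃ φ : e.partObj ⟶ f.partObj, PartInduced φ w := by
  rw [exists_hom_dualInduced_iff, exists_hom_partInduced_iff]
  rfl

/-- One `φ` serves all `w` inducing `σ`, so passing to `Π(X)` does not depend on the choice of `w`.
-/
theorem exists_part_of_dual (σ : e.hObj ⟶ f.hObj) :
    ∃ φ : e.partObj ⟶ f.partObj, ∀ w, DualInduced σ w → PartInduced φ w := by
  obtain ⟨w, hw⟩ := exists_dualInduced σ
  obtain ⟨φ, hφ⟩ := (exists_hom_dualInduced_iff_partInduced w).1 ⟨σ, hw⟩
  exact ⟨φ, fun w' hw' => hφ.congr (apply_eq_of_dualInduced hw hw')⟩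

theorem exists_dual_of_part (φ : e.partObj ⟶ f.partObj) :
    ∃ σ : e.hObj ⟶ f.hObj, ∀ w, PartInduced φ w → DualInduced σ w := by
  obtain ⟨w, hw⟩ := PartCat.exists_partInduced φ
  obtain ⟨σ, hσ⟩ := (exists_hom_dualInduced_iff_partInduced w).2 ⟨φ, hw⟩
  exact ⟨σ, fun w' hw' => dualInduced_congr hσ (hw.rel hw')⟩

end IdemTrans

/-- The object `F` of the normal dual and the partition `p` come from the same idempotent. -/
def Corresponds (F : NormalDual (powerIncl X)) (p : PartCat X) : Prop :=
  ∃ e : IdemTrans X, e.hObj = F ∧ e.partObj = p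

namespace Corresponds

variable {F G : NormalDual (powerIncl X)} {p q : PartCat X}

theorem part_eq (h : Corresponds F p) (h' : Corresponds F q) : p = q := by
  obtain ⟨e, rfl, rfl⟩ := h
  obtain ⟨f, hf, rfl⟩ := h'
  exact IdemTrans.partObj_eq_of_hObj_eq hf.symm

theorem dual_eq (h : Corresponds F p) (h' : Corresponds G p) : F = G := by
  obtain ⟨e, rfl, rfl⟩ := h
  obtain ⟨f, rfl, hf⟩ := h'
  exact IdemTrans.hObj_eq_of_partObj_eq hf.symm

theorem exists_dualInduced (hF : Corresponds F p) (hG : Corresponds G q) (σ : F ⟶ G) :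
    ∃ w : X → X, DualInduced σ w := by
  obtain ⟨e, rfl, rfl⟩ := hF
  obtain ⟨f, rfl, rfl⟩ := hG
  exact IdemTrans.exists_dualInduced σ

theorem exists_part_of_dual (hF : Corresponds F p) (hG : Corresponds G q) (σ : F ⟶ G) :
    ∃ φ : p ⟶ q, ∀ w, DualInduced σ w → PartInduced φ w := by
  obtain ⟨e, rfl, rfl⟩ := hF
  obtain ⟨f, rfl, rfl⟩ := hG
  exact IdemTrans.exists_part_of_dual σ

theorem exists_dual_of_part (hF : Corresponds F p) (hG : Corresponds G q) (φ : p ⟶ q) :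
    ∃ σ : F ⟶ G, ∀ w, PartInduced φ w → DualInduced σ w := by
  obtain ⟨e, rfl, rfl⟩ := hF
  obtain ⟨f, rfl, rfl⟩ := hG
  exact IdemTrans.exists_dual_of_part φ

theorem inclLE_iff (hF : Corresponds F p) (hG : Corresponds G q) :
    InclLE (dualIncl (powerIncl X)) F G ↔ InclLE (partIncl X) p q := by
  simp only [InclLE, dualIncl_iff, partIncl_iff]
  obtain ⟨e, rfl, rfl⟩ := hF
  obtain ⟨f, rfl, rfl⟩ := hG
  exact IdemTrans.exists_hom_dualInduced_iff_partInduced id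

end Corresponds

theorem exists_corresponds_part (F : NormalDual (powerIncl X)) : ∃ p, Corresponds F p :=
  let ⟨e, he⟩ := exists_hObj_eq F
  ⟨e.partObj, e, he.symm, rfl⟩

theorem exists_corresponds_dual (p : PartCat X) : ∃ F, Corresponds F p :=
  let ⟨e, he⟩ := IdemTrans.exists_partObj_eq p
  ⟨e.hObj, e, rfl, he⟩

theorem NormalDual.exists_dualInduced {F G : NormalDual (powerIncl X)} (σ : F ⟶ G) :
    ∃ w : X → X, DualInduced σ w :=
  (exists_corresponds_part F).choose_spec.exists_dualInduced
    (exists_corresponds_part G).choose_spec σ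

/-! ### The functors -/

/-- The functor laws hold because both sides are induced by the same transformation, and this
determines a morphism of `Π(X)`. -/
theorem exists_dualToPart : ∃ P : NormalDual (powerIncl X) ⥤ PartCat X,
    (∀ F, Corresponds F (P.obj F)) ∧
    ∀ {F G : NormalDual (powerIncl X)} (σ : F ⟶ G) (w : X → X), DualInduced σ w →
      PartInduced (P.map σ) w := by
  choose obj hobj using exists_corresponds_part (X := X)
  choose map hmap using fun (F G : NormalDual (powerIncl X)) (σ : F ⟶ G) =>
    (hobj F).exists_part_of_dual (hobj G) σ
  refine ⟨⟨obj, fun σ => map _ _ σ, fun F => ?_, fun σ τ => ?_⟩, hobj,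
    fun σ w h => hmap _ _ σ w h⟩
  · exact (hmap _ _ _ _ (dualInduced_eqToHom (rfl : F = F))).hom_eq (partInduced_eqToHom rfl)
  · obtain ⟨w, hw⟩ := NormalDual.exists_dualInduced σ
    obtain ⟨w', hw'⟩ := NormalDual.exists_dualInduced τ
    exact (hmap _ _ _ _ (hw.comp hw')).hom_eq ((hmap _ _ _ _ hw).comp (hmap _ _ _ _ hw'))

theorem exists_partToDual : ∃ Q : PartCat X ⥤ NormalDual (powerIncl X),
    (∀ p, Corresponds (Q.obj p) p) ∧
    ∀ {p q : PartCat X} (φ : p ⟶ q) (w : X → X), PartInduced φ w →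
      DualInduced (Q.map φ) w := by
  choose obj hobj using exists_corresponds_dual (X := X)
  choose map hmap using fun (p q : PartCat X) (φ : p ⟶ q) =>
    (hobj p).exists_dual_of_part (hobj q) φ
  refine ⟨⟨obj, fun φ => map _ _ φ, fun p => ?_, fun φ ψ => ?_⟩, hobj,
    fun φ w h => hmap _ _ φ w h⟩
  · exact (hmap _ _ _ _ (partInduced_eqToHom (rfl : p = p))).hom_eq (dualInduced_eqToHom rfl)
  · obtain ⟨w, hw⟩ := PartCat.exists_partInduced φ
    obtain ⟨w', hw'⟩ := PartCat.exists_partInduced ψ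
    exact (hmap _ _ _ _ (hw.comp hw')).hom_eq ((hmap _ _ _ _ hw).comp (hmap _ _ _ _ hw'))

theorem IdemTrans.partInduced_eta {e f : IdemTrans X} (w : f.imageObj ⟶ e.imageObj) :
    PartInduced (PartCat.homOf (eta w)) fun x => (w ⟨f.toFun x, x, rfl⟩).1 :=
  (partInduced_homOf_iff _ _).2 fun _ => rfl

/-- The point picked in the block of `y` is `e y`, which lies in that block by idempotence. -/
theorem IdemTrans.partInduced_trans {e f : IdemTrans X}
    (η : Quotient f.partObj.rel → Quotient e.partObj.rel) :
    PartInduced (PartCat.homOf η) (trans η) := by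
  refine (partInduced_homOf_iff _ _).2 fun x => ?_
  change _ = Quotient.mk e.partObj.rel (Setoid.kerLift e.toFun (η (Quotient.mk f.partObj.rel x)))
  induction η (Quotient.mk f.partObj.rel x) using Quotient.inductionOn with
  | h y => exact Quotient.sound (e.idem y).symm

end

theorem theorem27 (X : Type u) :
    -- both categories are normal categories
    IsNormalCategory (dualIncl (powerIncl X)) ∧
    IsNormalCategory (partIncl X) ∧
    -- the objects of the normal dual are the functors `H(e; -)`
    (∀ F : NormalDual (powerIncl X), ∃ e : IdemTrans X, F = e.hObj) ∧
    -- to each morphism `σ : H(e; -) ⟶ H(f; -)` belongs a unique `σ̂ : Im f → Im e`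
    (∀ (e f : IdemTrans X) (σ : e.hObj ⟶ f.hObj),
      ∃! v : f.imageObj ⟶ e.imageObj, IsHat σ v) ∧
    -- the mutually inverse functors
    ∃ (P : NormalDual (powerIncl X) ⥤ PartCat X) (Q : PartCat X ⥤ NormalDual (powerIncl X))
      (hP : ∀ e : IdemTrans X, P.obj e.hObj = e.partObj)
      (hQ : ∀ e : IdemTrans X, Q.obj e.partObj = e.hObj),
      -- `P(σ) = P_σ̂`
      (∀ (e f : IdemTrans X) (σ : e.hObj ⟶ f.hObj) (v : f.imageObj ⟶ e.imageObj), IsHat σ v →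
        P.map σ = eqToHom (hP e) ≫ PartCat.homOf (IdemTrans.eta v) ≫ eqToHom (hP f).symm) ∧
      -- `Q(P_η)` is `a ↦ v a`, where `v` is the transformation determined by `η : π_f → π_e`
      (∀ (e f : IdemTrans X) (η : Quotient f.partObj.rel → Quotient e.partObj.rel)
        (σ : e.hObj ⟶ f.hObj),
        σ = eqToHom (hQ e).symm ≫ Q.map (PartCat.homOf η) ≫ eqToHom (hQ f) →
        ∀ (A : PowerSetCat X) (a : (e.hObj.obj.obj A).carrier) (α : X → X), Represents a.1 α →
          Represents (σ.hom.app A a).1 (α ∘ IdemTrans.trans η)) ∧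
      -- `P` and `Q` are inverse isomorphisms of normal categories
      P ⋙ Q = 𝟭 (NormalDual (powerIncl X)) ∧
      Q ⋙ P = 𝟭 (PartCat X) ∧
      IsNormalCategoryIso (dualIncl (powerIncl X)) (partIncl X) P ∧
      IsNormalCategoryIso (partIncl X) (dualIncl (powerIncl X)) Q := by

  obtain ⟨P, hPobj, hPmap⟩ := exists_dualToPart (X := X)
  obtain ⟨Q, hQobj, hQmap⟩ := exists_partToDual (X := X)
  -- The round trip keeps the inducing `w`, and the `eqToHom` corrections are induced by `id`.
  have hPQ : P ⋙ Q = 𝟭 (NormalDual (powerIncl X)) := by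
    refine CategoryTheory.Functor.ext (fun F => (hQobj _).dual_eq (hPobj F)) fun F G σ => ?_
    obtain ⟨w, hw⟩ := NormalDual.exists_dualInduced σ
    exact (hQmap _ _ (hPmap _ _ hw)).hom_eq
      ((dualInduced_eqToHom _).comp (hw.comp (dualInduced_eqToHom _)))
  have hQP : Q ⋙ P = 𝟭 (PartCat X) := by
    refine CategoryTheory.Functor.ext (fun p => (hPobj _).part_eq (hQobj p)) fun p q φ => ?_
    obtain ⟨w, hw⟩ := PartCat.exists_partInduced φ
    exact (hPmap _ _ (hQmap _ _ hw)).hom_eq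
      ((partInduced_eqToHom _).comp (hw.comp (partInduced_eqToHom _)))
  have hPiso : IsNormalCategoryIso (dualIncl (powerIncl X)) (partIncl X) P :=
    .of_inverse hPQ hQP
      (fun σ hσ => (partIncl_iff _).2 (hPmap _ _ ((dualIncl_iff σ).1 hσ)))
      fun F G => ((hPobj F).inclLE_iff (hPobj G)).2
  have hQiso : IsNormalCategoryIso (partIncl X) (dualIncl (powerIncl X)) Q :=
    .of_inverse hQP hPQ
      (fun φ hφ => (dualIncl_iff _).2 (hQmap _ _ ((partIncl_iff φ).1 hφ)))
      fun p q => ((hQobj p).inclLE_iff (hQobj q)).1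
  refine ⟨hPiso.isNormalCategory partIncl_isNormalCategory, partIncl_isNormalCategory,
    exists_hObj_eq, fun e f σ => existsUnique_isHat σ, P, Q,
    fun e => (hPobj _).part_eq ⟨e, rfl, rfl⟩, fun e => (hQobj _).dual_eq ⟨e, rfl, rfl⟩,
    fun e f σ w hw => ?_, fun e f η σ hσ => ?_, hPQ, hQP, hPiso, hQiso⟩
  · exact (hPmap _ _ (IdemTrans.dualInduced_of_isHat hw)).hom_eq
      ((partInduced_eqToHom _).comp ((IdemTrans.partInduced_eta w).comp (partInduced_eqToHom _)))
  · rw [hσ]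
    exact (dualInduced_eqToHom _).comp
      ((hQmap _ _ (IdemTrans.partInduced_trans η)).comp (dualInduced_eqToHom _))
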